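/- Let $h\colon\mathbb R\to\mathbb R$ be a $2\pi$-periodic $C^1$-function, of class $C^2$ on $\mathbb R\setminus 2\pi\mathbb Z$, such that $h(0)=0$ and $$h(x)=|x|\Big(\log\Big|\log\frac{|x|}{e}\Big|\Big)^{-1/2},\qquad 0<|x|\le e^{-1}.$$ Let $\mathbb T$ be the unit circle in $\mathbb C$, let $g\colon\mathbb T\to\mathbb C$ be given by $g(e^{i\theta})=h(\theta)$, and let $f(z)=(z-1)g(z)$, $z\in\mathbb T$; then $f\in C^2(\mathbb T)$. Let $f^{[1]}$ and $f^{[2]}$ be the divided differences of $f$: for $z_0,z_1,z_2\in\mathbb T$, $f^{[1]}(z_0,z_1)=\frac{f(z_0)-f(z_1)}{z_0-z_1}$ if $z_0\ne z_1$ and $f^{[1]}(z_0,z_0)=\frac{d}{dz}f(z)|_{z=z_0}$; $f^{[2]}(z_0,z_1,z_2)=\frac{f^{[1]}(z_0,z_1)-f^{[1]}(z_1,z_2)}{z_0-z_2}$ if $z_0\ne z_2$ and $f^{[2]}(z_0,z_1,z_0)=\frac{d}{dz}f^{[1]}(z,z_1)|_{z=z_0}$, where derivatives are taken along $\mathbb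 T$. For a unitary operator $U$ on $\ell^2_N=\mathbb C^N$ with spectral decomposition $U=\sum_{i=1}^N z_iP_i$ ($P_i$ pairwise orthogonal rank one orthogonal projections) and operators $X,Y$ on $\ell^2_N$ put $$T^{U,U,U}_{f^{[2]}}(X,Y)=\sum_{i,j,k=1}^N f^{[2]}(z_i,z_k,z_j)\,P_iXP_kYP_j ,$$ which does not depend on the chosen decomposition. Let $\|\cdot\|_p$ be the Schatten $p$-norm. Then there is a constant $c>0$ such that for every integer $n\ge 3$ there are a self-adjoint operator $W_n$ on $\ell^2_{8n+4}$ with $\|W_n\|_2\le 1$ and a unitary operator $U_n$ on $\ell^2_{8n+4}$ such that $$\big\|T^{U_n,U_n,U_n}_{f^{[2]}}(W_nU_n,W_nU_n)\big\|_1\ \ge\ c\,(\log n)^{1/2}.$$ -/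

import Mathlib

noncomputable section

namespace PellerUnitary

section Operators

variable {E : Type*} [NormedAddCommGroup E] [InnerProductSpace ℂ E] [FiniteDimensional ℂ E]

/-- The Schatten `p`-norm `(∑ s_i(A) ^ p) ^ (1 / p)`, `1 ≤ p < ∞`, of an operator on a
finite-dimensional Hilbert space, where `s_i(A)` are its singular values. -/
def schattenNorm (p : ℝ) (A : E →L[ℂ] E) : ℝ :=
  (∑ i ∈ Finset.range (Module.finrank ℂ E), (A : E →ₗ[ℂ] E).singularValues i ^ p) ^ (1 / p)

/-- The orthogonal projection onto the eigenspace of `U` for `z`. -/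
def spectralProj (U : E →L[ℂ] E) (z : ℂ) : E →L[ℂ] E :=
  (Module.End.eigenspace (U : E →ₗ[ℂ] E) z).starProjection

/-- The triple operator integral `T_ψ^{U₀,U₁,U₂}(X, Y)` of normal operators `U₀, U₁, U₂`, as a sum
over their spectra. `tripleOperatorIntegral_eq` below expresses it through arbitrary
orthonormal bases of eigenvectors. -/
def tripleOperatorIntegral (ψ : ℂ → ℂ → ℂ → ℂ) (U₀ U₁ U₂ X Y : E →L[ℂ] E) : E →L[ℂ] E :=
  ∑ z₀ : Module.End.Eigenvalues (U₀ : E →ₗ[ℂ] E),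
    ∑ z₁ : Module.End.Eigenvalues (U₁ : E →ₗ[ℂ] E),
      ∑ z₂ : Module.End.Eigenvalues (U₂ : E →ₗ[ℂ] E),
        ψ z₀ z₁ z₂ • (spectralProj U₀ z₀ * X * spectralProj U₁ z₁ * Y * spectralProj U₂ z₂)

/-- The orthogonal projection onto the line spanned by `v`. -/
def lineProj (v : E) : E →L[ℂ] E :=
  (Submodule.span ℂ {v}).starProjection

theorem spectralProj_eq {ι : Type*} [Fintype ι] (U : E →L[ℂ] E) (b : OrthonormalBasis ι ℂ E)
    (z : ι → ℂ) (hb : ∀ i, U (b i) = z i • b i) (w : ℂ) :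
    spectralProj U w = ∑ i, if z i = w then lineProj (b i) else 0 := by
  classical
  have key : ∀ j, spectralProj U w (b j)
      = (∑ i, if z i = w then lineProj (b i) else 0) (b j) := by
    intro j
    have hR : (∑ i, if z i = w then lineProj (b i) else 0) (b j)
        = if z j = w then b j else 0 := by
      rw [sum_apply, Finset.sum_eq_single j]
      · split_ifs
        · exact Submodule.starProjection_eq_self_iff.2 (Submodule.mem_span_singleton_self _)
        · rfl
      · intro i _ hij
        split_ifs
        · rw [lineProj, Submodule.starProjection_unit_singleton ℂ (b.norm_eq_one i),
            b.inner_eq_ite, if_neg hij, zero_smul]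
        · rfl
      · simp
    rw [hR]
    split_ifs with h
    · refine Submodule.starProjection_eq_self_iff.2 ?_
      rw [Module.End.mem_eigenspace_iff]
      simpa [h] using hb j
    · refine (Submodule.starProjection_apply_eq_zero_iff _).2 ?_
      rw [Submodule.mem_orthogonal']
      intro v hv
      rw [Module.End.mem_eigenspace_iff] at hv
      have hv' : U v = w • v := hv
      have h1 : U v = ∑ i, (inner ℂ (b i) v * z i) • b i := by
        conv_lhs => rw [← b.sum_repr' v]
        simp [map_sum, hb, smul_smul]
      have h2 : inner ℂ (b j) (U v) = inner ℂ (b j) v * z j := by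
        rw [h1, b.orthonormal.inner_right_fintype]
      rw [hv', inner_smul_right] at h2
      have h3 : (w - z j) * inner ℂ (b j) v = 0 := by linear_combination h2
      rcases mul_eq_zero.1 h3 with h4 | h4
      · exact absurd (sub_eq_zero.1 h4).symm h
      · exact h4
  ext1 v
  rw [← b.sum_repr' v]
  simp only [map_sum, map_smul, key]

theorem sum_spectralProj {ι : Type*} [Fintype ι] {M : Type*} [AddCommMonoid M]
    (U : E →L[ℂ] E) (b : OrthonormalBasis ι ℂ E)
    (z : ι → ℂ) (hb : ∀ i, U (b i) = z i • b i) (G : ℂ → (E →L[ℂ] E) →+ M) :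
    ∑ w : Module.End.Eigenvalues (U : E →ₗ[ℂ] E), G w (spectralProj U w)
      = ∑ i, G (z i) (lineProj (b i)) := by
  classical
  simp only [spectralProj_eq U b z hb, map_sum]
  rw [Finset.sum_comm]
  refine Finset.sum_congr rfl fun i _ => ?_
  have hz : Module.End.HasEigenvalue (U : E →ₗ[ℂ] E) (z i) :=
    Module.End.hasEigenvalue_of_hasEigenvector (x := b i)
      ⟨Module.End.mem_eigenspace_iff.2 (hb i), b.orthonormal.ne_zero i⟩
  let w₀ : Module.End.Eigenvalues (U : E →ₗ[ℂ] E) := ⟨z i, hz⟩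
  have hw₀ : Module.End.UnifEigenvalues.val _ 1 w₀ = z i := rfl
  rw [Finset.sum_eq_single_of_mem w₀ (Finset.mem_univ _), hw₀, if_pos rfl]
  intro w _ hw
  rw [if_neg fun hzw => hw (Subtype.ext hzw.symm), map_zero]

/-- `T_ψ^{U₀,U₁,U₂}(X, Y) = ∑ ψ(z_i, z_k, z_j) P_i X P_k Y P_j` for any orthonormal bases of
eigenvectors of `U₀, U₁, U₂`. -/
theorem tripleOperatorIntegral_eq {ι₀ ι₁ ι₂ : Type*} [Fintype ι₀] [Fintype ι₁] [Fintype ι₂]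
    (ψ : ℂ → ℂ → ℂ → ℂ) (U₀ U₁ U₂ X Y : E →L[ℂ] E)
    (b₀ : OrthonormalBasis ι₀ ℂ E) (z₀ : ι₀ → ℂ) (h₀ : ∀ i, U₀ (b₀ i) = z₀ i • b₀ i)
    (b₁ : OrthonormalBasis ι₁ ℂ E) (z₁ : ι₁ → ℂ) (h₁ : ∀ i, U₁ (b₁ i) = z₁ i • b₁ i)
    (b₂ : OrthonormalBasis ι₂ ℂ E) (z₂ : ι₂ → ℂ) (h₂ : ∀ i, U₂ (b₂ i) = z₂ i • b₂ i) :
    tripleOperatorIntegral ψ U₀ U₁ U₂ X Y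
      = ∑ i, ∑ k, ∑ j, ψ (z₀ i) (z₁ k) (z₂ j) •
          (lineProj (b₀ i) * X * lineProj (b₁ k) * Y * lineProj (b₂ j)) := by
  let L : (E →L[ℂ] E) → (E →L[ℂ] E) → ℂ → (E →L[ℂ] E) →+ (E →L[ℂ] E) := fun A B c =>
    { toFun := fun P => c • (A * P * B)
      map_zero' := by simp
      map_add' := by intro P Q; simp [mul_add, add_mul] }
  have e2 : ∀ (a c : ℂ) (A : E →L[ℂ] E),
      ∑ w : Module.End.Eigenvalues (U₂ : E →ₗ[ℂ] E), ψ a c w • (A * spectralProj U₂ w)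
        = ∑ j, ψ a c (z₂ j) • (A * lineProj (b₂ j)) := by
    intro a c A
    simpa [L] using sum_spectralProj U₂ b₂ z₂ h₂ (fun w => L A 1 (ψ a c w))
  have e1 : ∀ (a : ℂ) (A : E →L[ℂ] E),
      ∑ w : Module.End.Eigenvalues (U₁ : E →ₗ[ℂ] E), ∑ j,
          ψ a w (z₂ j) • (A * X * spectralProj U₁ w * Y * lineProj (b₂ j))
        = ∑ k, ∑ j, ψ a (z₁ k) (z₂ j) • (A * X * lineProj (b₁ k) * Y * lineProj (b₂ j)) := by
    intro a A
    simpa [L, mul_assoc] using sum_spectralProj U₁ b₁ z₁ h₁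
      (fun w => ∑ j, L (A * X) (Y * lineProj (b₂ j)) (ψ a w (z₂ j)))
  have e0 : ∑ w : Module.End.Eigenvalues (U₀ : E →ₗ[ℂ] E), ∑ k, ∑ j,
          ψ w (z₁ k) (z₂ j) •
            (spectralProj U₀ w * X * lineProj (b₁ k) * Y * lineProj (b₂ j))
        = ∑ i, ∑ k, ∑ j, ψ (z₀ i) (z₁ k) (z₂ j) •
            (lineProj (b₀ i) * X * lineProj (b₁ k) * Y * lineProj (b₂ j)) := by
    simpa [L, mul_assoc] using sum_spectralProj U₀ b₀ z₀ h₀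
      (fun w => ∑ k, ∑ j, L 1 (X * lineProj (b₁ k) * Y * lineProj (b₂ j)) (ψ w (z₁ k) (z₂ j)))
  rw [← e0, tripleOperatorIntegral]
  simp only [e2, e1]

end Operators

/-- The unit circle `𝕋` in `ℂ`. -/
abbrev unitCircle : Set ℂ := Metric.sphere 0 1

/-- The first divided difference `f^{[1]}` on `𝕋²`; derivatives are taken along `𝕋`, i.e. as limits
of `(f w - f z) / (w - z)` with `w ∈ 𝕋`, `w → z`. -/
def dividedDiff₁ (f : ℂ → ℂ) (z₀ z₁ : ℂ) : ℂ :=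
  if z₀ = z₁ then derivWithin f unitCircle z₀ else (f z₀ - f z₁) / (z₀ - z₁)

/-- The second divided difference `f^{[2]}` on `𝕋³`. -/
def dividedDiff₂ (f : ℂ → ℂ) (z₀ z₁ z₂ : ℂ) : ℂ :=
  if z₀ = z₂ then derivWithin (fun z => dividedDiff₁ f z z₁) unitCircle z₀
  else (dividedDiff₁ f z₀ z₁ - dividedDiff₁ f z₁ z₂) / (z₀ - z₂)

/-- The function `|x| (log |log (|x| / e)|) ^ (-1/2)`, with value `0` at `0`. -/
def h₀ (x : ℝ) : ℝ :=
  if x = 0 then 0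
  else |x| * (Real.log |Real.log (|x| / Real.exp 1)|) ^ (-(1 / 2) : ℝ)

/-- `h` is a `2π`-periodic `C¹` extension of the restriction of `h₀` to `[-e⁻¹, e⁻¹]`, of class
`C²` away from `2πℤ` (which makes `z ↦ (z - 1) g(z)`, `g(e^{iθ}) = h(θ)`, of class `C²` on `𝕋`). -/
structure IsAdmissible (h : ℝ → ℝ) : Prop where
  eq_h₀ : ∀ x ∈ Set.Icc (-Real.exp (-1)) (Real.exp (-1)), h x = h₀ x
  periodic : Function.Periodic h (2 * Real.pi)
  contDiff_one : ContDiff ℝ 1 h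
  contDiffOn_two : ContDiffOn ℝ 2 h {x | ∀ k : ℤ, x ≠ k * (2 * Real.pi)}

/-- For a `2π`-periodic `h`, the function on `𝕋` with `g(e^{iθ}) = h(θ)`. -/
def circleFun (h : ℝ → ℝ) (z : ℂ) : ℂ := (h z.arg : ℂ)

theorem circleFun_exp {h : ℝ → ℝ} (hh : Function.Periodic h (2 * Real.pi)) (θ : ℝ) :
    circleFun h (Complex.exp (θ * Complex.I)) = (h θ : ℂ) := by
  rw [circleFun, Complex.arg_exp_mul_I, toIocMod, hh.sub_zsmul_eq]

/-- The function `f(z) = (z - 1) g(z)`, where `g(e^{iθ}) = h(θ)`. -/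
def fFun (h : ℝ → ℝ) (z : ℂ) : ℂ := (z - 1) * circleFun h z

end PellerUnitary

end

noncomputable section

namespace PellerUnitary

/-! ### Hilbert's inequality, from the Fourier series of the sawtooth. -/

section Hilbert

open Complex

/-! Since `f(1) = 0`, putting the eigenvalue `1` in the middle slot reduces `f^{[2]}(z, 1, w)` to
the first divided difference of `g` (`dividedDiff₂_fFun_one`). A perturbation that only couples the
eigenvector of `1` to the others keeps just this middle slot, so a block of the triple operator
integral is a Schur multiplier applied to a rank one matrix.

Take `z = e^{i a_k}` and `w = e^{-i a_l}` with `a_k = e^{-(k+1)}`. As `h` is even near `0`, the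
divided difference is, up to phases, about `(h(a_k) - h(a_l)) / (a_k + a_l)`. The geometric decay of
the angles makes it behave like `sign(l - k)` times the slowly varying weight `(log (k+2))^{-1/2}`
of the larger angle, `k` being the smaller index (`weight_div_four_le_symbol`): a damped triangular
truncation.

Its trace norm is bounded below by pairing with the Hilbert matrix `1/(l - k)`, of norm at most `π`.
Both kernels are odd, so all products are nonnegative and the pairing is at least of order `(log
n)^{-1/2} · n log n` (`sum_hilbertKernel_mul_symbol_ge`). Normalising the perturbation costs a
factor of order `1/n`, leaving `(log n)^{1/2}`. -/

theorem integral_exp_int_mul_I (d : ℤ) :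
    ∫ t in (0 : ℝ)..2 * Real.pi, exp (d * t * I) = if d = 0 then 2 * (Real.pi : ℂ) else 0 := by
  split_ifs with hd
  · simp [hd]
  · have hc : (d : ℂ) * I ≠ 0 := mul_ne_zero (by exact_mod_cast hd) I_ne_zero
    have h := integral_exp_mul_complex (a := 0) (b := 2 * Real.pi) hc
    have e : exp ((d : ℂ) * I * ((2 * Real.pi : ℝ) : ℂ)) = 1 := by
      rw [← exp_int_mul_two_pi_mul_I d]; congr 1; push_cast; ring
    rw [e] at h
    simp only [ofReal_zero, mul_zero, exp_zero, sub_self, zero_div] at h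
    rw [← h]
    congr 1; ext t; congr 1; ring

/-- Exhibits the Hilbert matrix as a Toeplitz matrix with bounded symbol. For `d = 0` the convention
`0⁻¹ = 0` matches the zero mean of the sawtooth. -/
theorem integral_sawtooth_mul_exp (d : ℤ) :
    ∫ t in (0 : ℝ)..2 * Real.pi, ((Real.pi - t : ℝ) : ℂ) * exp (d * t * I)
      = 2 * Real.pi * I * (d : ℂ)⁻¹ := by
  by_cases hd : d = 0
  · subst hd
    simp only [Int.cast_zero, zero_mul, exp_zero, mul_one, inv_zero, mul_zero]
    rw [intervalIntegral.integral_ofReal, intervalIntegral.integral_sub (by simp) (by simp)]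
    rw [integral_id, intervalIntegral.integral_const]
    simp only [smul_eq_mul, ofReal_eq_zero]; ring
  · have hd' : (d : ℂ) ≠ 0 := by exact_mod_cast hd
    have hc : (d : ℂ) * I ≠ 0 := mul_ne_zero hd' I_ne_zero
    have hder : ∀ t : ℝ, HasDerivAt (fun t : ℝ => ((Real.pi - t : ℝ) : ℂ) * exp (d * t * I) / (d * I)
        + exp (d * t * I) / (d * I) ^ 2) (((Real.pi - t : ℝ) : ℂ) * exp (d * t * I)) t := by
      intro t
      have h1 : HasDerivAt (fun t : ℝ => exp (d * t * I)) (exp (d * t * I) * (d * I)) t := by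
        have h0 : HasDerivAt (fun t : ℝ => (d : ℂ) * t * I) (d * I) t := by
          simpa using ((hasDerivAt_id t).ofReal_comp.const_mul (d : ℂ)).mul_const I
        exact h0.cexp
      have h2 : HasDerivAt (fun t : ℝ => ((Real.pi - t : ℝ) : ℂ)) (-1) t := by
        simpa using ((hasDerivAt_id t).const_sub Real.pi).ofReal_comp
      convert! ((h2.mul h1).div_const (d * I)).add (h1.div_const ((d * I) ^ 2)) using 1
      field_simp
      ring
    rw [intervalIntegral.integral_eq_sub_of_hasDerivAt (fun t _ => hder t)
      (Continuous.intervalIntegrable (by fun_prop) _ _)]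
    have e : exp ((d : ℂ) * ((2 * Real.pi : ℝ) : ℂ) * I) = 1 := by
      rw [← exp_int_mul_two_pi_mul_I d]; congr 1; push_cast; ring
    rw [e]
    simp only [ofReal_zero, mul_zero, zero_mul, exp_zero]
    push_cast
    field_simp
    rw [I_pow_three]; ring

variable {n : ℕ}

/-- The trigonometric polynomial with coefficients `x` and frequencies `f`. -/
def trigPoly (f : Fin n → ℤ) (x : Fin n → ℂ) (t : ℝ) : ℂ := ∑ k, x k * exp (f k * t * I)

@[fun_prop]
theorem continuous_trigPoly (f : Fin n → ℤ) (x : Fin n → ℂ) : Continuous (trigPoly f x) := by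
  unfold trigPoly
  fun_prop

theorem integral_norm_sq_trigPoly (f : Fin n → ℤ) (hf : Function.Injective f) (x : Fin n → ℂ) :
    ∫ t in (0 : ℝ)..2 * Real.pi, ‖trigPoly f x t‖ ^ 2 = 2 * Real.pi * ∑ k, ‖x k‖ ^ 2 := by
  have hpt : ∀ t : ℝ, ((‖trigPoly f x t‖ ^ 2 : ℝ) : ℂ)
      = ∑ k, ∑ l, x k * (starRingEnd ℂ) (x l) * exp ((f k - f l : ℤ) * t * I) := by
    intro t
    rw [ofReal_pow, ← mul_conj', trigPoly, map_sum, Finset.sum_mul_sum]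
    refine Finset.sum_congr rfl fun k _ => Finset.sum_congr rfl fun l _ => ?_
    rw [map_mul, ← exp_conj]
    simp only [map_mul, conj_I, conj_ofReal, map_intCast]
    rw [mul_mul_mul_comm, ← exp_add]
    congr 2; push_cast; ring
  apply ofReal_injective
  rw [← intervalIntegral.integral_ofReal]
  simp_rw [hpt]
  rw [intervalIntegral.integral_finsetSum
    fun k _ => Continuous.intervalIntegrable (by fun_prop) _ _]
  rw [ofReal_mul, ofReal_sum, Finset.mul_sum]
  refine Finset.sum_congr rfl fun k _ => ?_
  rw [intervalIntegral.integral_finsetSum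
    fun k _ => Continuous.intervalIntegrable (by fun_prop) _ _]
  simp_rw [intervalIntegral.integral_const_mul, integral_exp_int_mul_I, sub_eq_zero, hf.eq_iff]
  simp only [mul_ite, mul_zero, Finset.sum_ite_eq, Finset.mem_univ, if_true]
  rw [mul_conj']; push_cast; ring

/-- The entries `1 / (l - k)` of the Hilbert matrix, with zero diagonal. -/
def hilbertKernel (k l : ℕ) : ℝ := ((l : ℝ) - k)⁻¹

/-- The form is an integral of the sawtooth against the product of two trigonometric polynomials;
bound the sawtooth by `π` and apply AM-GM and Parseval. -/
theorem norm_sum_hilbertKernel_le_add (x y : Fin n → ℂ) :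
    ‖∑ k : Fin n, ∑ l : Fin n, (hilbertKernel k l : ℂ) * x k * y l‖
      ≤ Real.pi * ((∑ k, ‖x k‖ ^ 2 + ∑ l, ‖y l‖ ^ 2) / 2) := by
  have hpi := Real.pi_pos
  set X := trigPoly (fun k : Fin n => -(k : ℤ)) x with hX
  set Y := trigPoly (fun k : Fin n => (k : ℤ)) y with hY
  -- The frequencies `-k` in `X` and `l` in `Y` make `X * Y` carry the difference `l - k`.
  have hXc : Continuous X := continuous_trigPoly _ _
  have hYc : Continuous Y := continuous_trigPoly _ _
  have hinjY : Function.Injective (fun k : Fin n => (k : ℤ)) := fun a b hab => by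
    simpa [Fin.ext_iff] using hab
  have hinjX : Function.Injective (fun k : Fin n => -(k : ℤ)) := neg_injective.comp hinjY
  have hint : ∫ t in (0 : ℝ)..2 * Real.pi, ((Real.pi - t : ℝ) : ℂ) * (X t * Y t)
      = 2 * Real.pi * I * ∑ k : Fin n, ∑ l : Fin n, (hilbertKernel k l : ℂ) * x k * y l := by
    have hpt : ∀ t : ℝ, ((Real.pi - t : ℝ) : ℂ) * (X t * Y t) = ∑ k : Fin n, ∑ l : Fin n, x k * y l *
        (((Real.pi - t : ℝ) : ℂ) * exp (((l : ℤ) - (k : ℤ) : ℤ) * t * I)) := by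
      intro t
      rw [hX, hY, trigPoly, trigPoly, Finset.sum_mul_sum, Finset.mul_sum]
      refine Finset.sum_congr rfl fun k _ => ?_
      rw [Finset.mul_sum]
      refine Finset.sum_congr rfl fun l _ => ?_
      rw [mul_mul_mul_comm, ← exp_add, mul_left_comm]
      congr 3; push_cast; ring
    simp_rw [hpt]
    rw [intervalIntegral.integral_finsetSum
      fun k _ => Continuous.intervalIntegrable (by fun_prop) _ _, Finset.mul_sum]
    refine Finset.sum_congr rfl fun k _ => ?_
    rw [intervalIntegral.integral_finsetSum
      fun k _ => Continuous.intervalIntegrable (by fun_prop) _ _, Finset.mul_sum]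
    refine Finset.sum_congr rfl fun l _ => ?_
    rw [intervalIntegral.integral_const_mul, integral_sawtooth_mul_exp, hilbertKernel]
    push_cast
    ring
  have hle : ‖∫ t in (0 : ℝ)..2 * Real.pi, ((Real.pi - t : ℝ) : ℂ) * (X t * Y t)‖
      ≤ ∫ t in (0 : ℝ)..2 * Real.pi, Real.pi / 2 * (‖X t‖ ^ 2 + ‖Y t‖ ^ 2) := by
    refine intervalIntegral.norm_integral_le_of_norm_le (by positivity) ?_
      (Continuous.intervalIntegrable (by fun_prop) _ _)
    refine Filter.Eventually.of_forall fun t ht => ?_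
    rw [norm_mul, norm_mul, norm_real, Real.norm_eq_abs]
    have h1 : |Real.pi - t| ≤ Real.pi := abs_le.2 ⟨by linarith [ht.2], by linarith [ht.1]⟩
    have h2 : ‖X t‖ * ‖Y t‖ ≤ (‖X t‖ ^ 2 + ‖Y t‖ ^ 2) / 2 := by
      linarith [two_mul_le_add_sq ‖X t‖ ‖Y t‖]
    calc |Real.pi - t| * (‖X t‖ * ‖Y t‖) ≤ Real.pi * ((‖X t‖ ^ 2 + ‖Y t‖ ^ 2) / 2) := by gcongr
      _ = _ := by ring
  rw [hint, norm_mul, intervalIntegral.integral_const_mul, intervalIntegral.integral_add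
    (Continuous.intervalIntegrable (by fun_prop) _ _)
    (Continuous.intervalIntegrable (by fun_prop) _ _), hX, hY,
    integral_norm_sq_trigPoly _ hinjX, integral_norm_sq_trigPoly _ hinjY] at hle
  have hn : ‖2 * (Real.pi : ℂ) * I‖ = 2 * Real.pi := by
    simp [abs_of_pos hpi]
  rw [hn] at hle
  refine le_of_mul_le_mul_left (hle.trans_eq ?_) (by positivity : 0 < 2 * Real.pi)
  ring

/-- Hilbert's inequality for the matrix `1 / (l - k)`. -/
theorem norm_sum_hilbertKernel_le (x y : Fin n → ℂ) :
    ‖∑ k : Fin n, ∑ l : Fin n, (hilbertKernel k l : ℂ) * x k * y l‖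
      ≤ Real.pi * (√(∑ k, ‖x k‖ ^ 2) * √(∑ l, ‖y l‖ ^ 2)) := by
  set a := √(∑ k, ‖x k‖ ^ 2) with ha
  set b := √(∑ k, ‖y k‖ ^ 2) with hb
  have hzero : ∀ z : Fin n → ℂ, √(∑ k, ‖z k‖ ^ 2) = 0 → ∀ k, z k = 0 := by
    intro z hz k
    rw [Real.sqrt_eq_zero (by positivity)] at hz
    have := (Finset.sum_eq_zero_iff_of_nonneg (fun i _ => by positivity)).1 hz k (Finset.mem_univ k)
    simpa using this
  rcases eq_or_ne a 0 with h0 | h0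
  · simp [h0, hzero x h0]
  rcases eq_or_ne b 0 with h1 | h1
  · simp [h1, hzero y h1]
  have ha0 : 0 < a := lt_of_le_of_ne (Real.sqrt_nonneg _) h0.symm
  have hb0 : 0 < b := lt_of_le_of_ne (Real.sqrt_nonneg _) h1.symm
  have ha2 : ∑ k, ‖x k‖ ^ 2 = a ^ 2 := (Real.sq_sqrt (by positivity)).symm
  have hb2 : ∑ k, ‖y k‖ ^ 2 = b ^ 2 := (Real.sq_sqrt (by positivity)).symm
  -- Normalising both vectors turns the bound by a mean into one by a product.
  have key := norm_sum_hilbertKernel_le_add (fun k => (a : ℂ)⁻¹ * x k) (fun l => (b : ℂ)⁻¹ * y l)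
  have e1 : ∑ k : Fin n, ∑ l : Fin n, (hilbertKernel k l : ℂ) * ((a : ℂ)⁻¹ * x k) * ((b : ℂ)⁻¹ * y l)
      = ((a : ℂ)⁻¹ * (b : ℂ)⁻¹) * ∑ k : Fin n, ∑ l : Fin n, (hilbertKernel k l : ℂ) * x k * y l := by
    simp only [Finset.mul_sum]
    refine Finset.sum_congr rfl fun k _ => Finset.sum_congr rfl fun l _ => ?_
    ring
  have e2 : ∀ (c : ℝ) (z : Fin n → ℂ), 0 < c → ∑ k, ‖z k‖ ^ 2 = c ^ 2 →
      ∑ k, ‖(c : ℂ)⁻¹ * z k‖ ^ 2 = 1 := by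
    intro c z hc hz
    simp only [norm_mul, mul_pow, ← Finset.mul_sum, hz]
    rw [norm_inv, norm_real, Real.norm_of_nonneg hc.le]
    field_simp
  rw [e1, e2 a x ha0 ha2, e2 b y hb0 hb2, norm_mul, norm_mul, norm_inv, norm_inv, norm_real,
    norm_real, Real.norm_of_nonneg ha0.le, Real.norm_of_nonneg hb0.le, ← mul_inv,
    inv_mul_le_iff₀ (by positivity)] at key
  refine key.trans_eq ?_
  ring

end Hilbert

/-! ### Schatten norms, duality, and matrix entries of the triple operator integral. -/

section TraceNorm

variable {ι : Type*} [Fintype ι] [DecidableEq ι]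

/-- `op A` is the operator on `ℓ²(ι)` with matrix `A`. -/
local notation "op" => Matrix.toEuclideanCLM (n := ι) (𝕜 := ℂ)

/-- In an eigenbasis of `A* A`, the norms `‖A b_r‖` are the singular values. -/
theorem exists_schattenNorm_one_eq {E : Type*} [NormedAddCommGroup E] [InnerProductSpace ℂ E]
    [FiniteDimensional ℂ E] (A : E →L[ℂ] E) :
    ∃ b : OrthonormalBasis (Fin (Module.finrank ℂ E)) ℂ E, schattenNorm 1 A = ∑ r, ‖A (b r)‖ := by
  set T := (A : E →ₗ[ℂ] E)
  have hT := T.isSymmetric_adjoint_comp_self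
  refine ⟨hT.eigenvectorBasis rfl, ?_⟩
  simp only [schattenNorm, Real.rpow_one, div_one]
  rw [Finset.sum_range]
  refine Finset.sum_congr rfl fun r _ => ?_
  rw [T.singularValues_fin rfl, Real.sqrt_eq_iff_mul_self_eq
    (T.isPositive_adjoint_comp_self.nonneg_eigenvalues rfl r) (norm_nonneg _)]
  have h1 := hT.apply_eigenvectorBasis rfl r
  set v := hT.eigenvectorBasis rfl r
  have h2 : inner ℂ v ((T.adjoint ∘ₗ T) v) = (hT.eigenvalues rfl r : ℂ) := by
    rw [h1, inner_smul_right, inner_self_eq_norm_sq_to_K, OrthonormalBasis.norm_eq_one]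
    simp
  rw [LinearMap.comp_apply, LinearMap.adjoint_inner_right, inner_self_eq_norm_sq_to_K] at h2
  have h3 : ‖T v‖ ^ 2 = hT.eigenvalues rfl r := 
    Complex.ofReal_injective (by rw [Complex.ofReal_pow]; exact h2)
  rw [← h3, sq]; rfl

theorem schattenNorm_two_eq {E : Type*} [NormedAddCommGroup E] [InnerProductSpace ℂ E]
    [FiniteDimensional ℂ E] {κ : Type*} [Fintype κ] (b : OrthonormalBasis κ ℂ E) (A : E →L[ℂ] E) :
    schattenNorm 2 A = √(∑ i, ‖A (b i)‖ ^ 2) := by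
  set T := (A : E →ₗ[ℂ] E) with hTdef
  have hT := T.isSymmetric_adjoint_comp_self
  rw [schattenNorm, ← Real.sqrt_eq_rpow]
  congr 1
  rw [Finset.sum_range]
  have h1 : ∀ r : Fin (Module.finrank ℂ E),
      (A : E →ₗ[ℂ] E).singularValues r ^ (2 : ℝ) = hT.eigenvalues rfl r := by
    intro r
    rw [← T.sq_singularValues_fin rfl, ← Real.rpow_natCast]; rfl
  rw [Finset.sum_congr rfl fun r _ => h1 r, ← hT.re_trace_eq_sum_eigenvalues,
    LinearMap.trace_eq_sum_inner _ b, map_sum]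
  refine Finset.sum_congr rfl fun i _ => ?_
  rw [LinearMap.comp_apply, LinearMap.adjoint_inner_right, inner_self_eq_norm_sq]; rfl

/-- Duality between the trace norm and the operator norm: a bilinear form `β` of norm at most `C`
pairs with a submatrix of an operator to give at most `C` times its trace norm. -/
theorem norm_sum_mul_le_schattenNorm_one {m : ℕ} (β : Fin m → Fin m → ℂ) {C : ℝ}
    (hβ : ∀ x y : Fin m → ℂ, ‖∑ k, ∑ l, β k l * x k * y l‖
      ≤ C * (√(∑ k, ‖x k‖ ^ 2) * √(∑ l, ‖y l‖ ^ 2))) (hC : 0 ≤ C)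
    (p q : Fin m → ι) (hp : Function.Injective p) (hq : Function.Injective q) (A : Matrix ι ι ℂ) :
    ‖∑ k, ∑ l, β k l * A (p k) (q l)‖ ≤ C * schattenNorm 1 (op A) := by
  obtain ⟨b, hb⟩ := exists_schattenNorm_one_eq (op A)
  have hsub : ∀ (s : Fin m → ι), Function.Injective s → ∀ x : ι → ℂ,
      ∑ k, ‖x (s k)‖ ^ 2 ≤ ∑ i, ‖x i‖ ^ 2 := by
    intro s hs x
    rw [← Finset.sum_image (s := Finset.univ) (g := s) (f := fun i => ‖x i‖ ^ 2)
      (fun a _ c _ h => hs h)]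
    exact Finset.sum_le_sum_of_subset_of_nonneg (Finset.subset_univ _) fun _ _ _ => by positivity
  -- The rank one decomposition `A = ∑ (A b_r) b_r*`; the bound on `β` then applies to each term.
  have hentry : ∀ i j, A i j = ∑ r, op A (b r) i * (starRingEnd ℂ) (b r j) := by
    intro i j
    have h1 : op A (EuclideanSpace.single j 1) i = A i j := by
      simp [Matrix.ofLp_toEuclideanCLM]
    rw [← h1, ← b.sum_repr' (EuclideanSpace.single j 1), map_sum]
    simp [EuclideanSpace.inner_single_right, mul_comm]
  have hsum : ∑ k, ∑ l, β k l * A (p k) (q l)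
      = ∑ r, ∑ k, ∑ l, β k l * op A (b r) (p k) * (starRingEnd ℂ) (b r (q l)) := by
    rw [Finset.sum_comm]
    conv_rhs => rw [Finset.sum_comm]
    rw [Finset.sum_comm]
    refine Finset.sum_congr rfl fun k _ => ?_
    conv_rhs => rw [Finset.sum_comm]
    refine Finset.sum_congr rfl fun l _ => ?_
    rw [hentry, Finset.mul_sum]
    simp only [mul_assoc]
  rw [hsum, hb, Finset.mul_sum]
  refine (norm_sum_le _ _).trans (Finset.sum_le_sum fun r _ => ?_)
  refine (hβ (fun k => op A (b r) (p k)) (fun l => (starRingEnd ℂ) (b r (q l)))).trans ?_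
  gcongr
  have h1 : √(∑ k, ‖op A (b r) (p k)‖ ^ 2) ≤ ‖op A (b r)‖ := by
    rw [EuclideanSpace.norm_eq]
    exact Real.sqrt_le_sqrt (hsub p hp fun i => op A (b r) i)
  have h2 : √(∑ l, ‖(starRingEnd ℂ) (b r (q l))‖ ^ 2) ≤ 1 := by
    rw [← b.norm_eq_one r, EuclideanSpace.norm_eq]
    simp only [RCLike.norm_conj]
    exact Real.sqrt_le_sqrt (hsub q hq fun i => b r i)
  calc _ ≤ ‖op A (b r)‖ * 1 := by gcongr
    _ = _ := mul_one _

theorem lineProj_basisFun (i : ι) :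
    lineProj (EuclideanSpace.basisFun ι ℂ i) = op (Matrix.single i i 1) := by
  ext v j
  rw [lineProj, Submodule.starProjection_unit_singleton ℂ
    ((EuclideanSpace.basisFun ι ℂ).norm_eq_one i), Matrix.ofLp_toEuclideanCLM]
  simp [EuclideanSpace.inner_single_left, Matrix.single_mulVec, Function.update_apply]

theorem tripleOperatorIntegral_diagonal (ψ : ℂ → ℂ → ℂ → ℂ) (z : ι → ℂ) (X Y : Matrix ι ι ℂ) :
    tripleOperatorIntegral ψ (op (Matrix.diagonal z)) (op (Matrix.diagonal z))
        (op (Matrix.diagonal z)) (op X) (op Y)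
      = op (Matrix.of fun i j => ∑ k, ψ (z i) (z k) (z j) * X i k * Y k j) := by
  have hb : ∀ i, op (Matrix.diagonal z) (EuclideanSpace.basisFun ι ℂ i)
      = z i • EuclideanSpace.basisFun ι ℂ i := by
    intro i
    ext j
    rw [Matrix.ofLp_toEuclideanCLM]
    by_cases h : j = i
    · subst h; simp [Matrix.mulVec_diagonal]
    · simp [Matrix.mulVec_diagonal, h]
  rw [tripleOperatorIntegral_eq ψ _ _ _ _ _ _ z hb _ z hb _ z hb]
  simp only [lineProj_basisFun, ← map_mul, ← map_smul, ← map_sum]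
  congr 1
  ext a c
  simp only [Matrix.sum_apply, Matrix.smul_apply, Matrix.of_apply, smul_eq_mul]
  have hent : ∀ i k j, (Matrix.single i i (1 : ℂ) * X * Matrix.single k k 1 * Y
      * Matrix.single j j 1 : Matrix ι ι ℂ) a c
        = if i = a then if j = c then X i k * Y k j else 0 else 0 := by
    intro i k j
    split_ifs with h1 h2
    · subst h1; subst h2
      simp [mul_assoc, Matrix.mul_apply, Matrix.single_apply, ite_and]
    · rw [Matrix.mul_single_apply_of_ne _ _ _ _ _ (Ne.symm h2)]
    · rw [mul_assoc, mul_assoc, mul_assoc, Matrix.single_mul_apply_of_ne _ _ _ _ _ (Ne.symm h1)]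
  simp only [hent]
  rw [Finset.sum_eq_single_of_mem a (Finset.mem_univ _) (by intro i _ hi; simp [hi])]
  refine Finset.sum_congr rfl fun k _ => ?_
  rw [Finset.sum_eq_single_of_mem c (Finset.mem_univ _) (by intro i _ hi; simp [hi])]
  simp [mul_assoc]

end TraceNorm

/-! ### Logarithmic lower bounds and the divided differences at geometric angles. -/

section Estimates

/-- From `m` to `m + 1` the left side grows by at most `(log (m+1) + 1) / 2`, which is at most `log
(m+1)` because `m + 1 ≥ 3 > e`. -/
theorem half_mul_log_le_log_factorial (n : ℕ) :
    (n : ℝ) / 2 * Real.log n ≤ Real.log (n.factorial : ℝ) := by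
  rcases lt_or_ge n 2 with hn | hn
  · interval_cases n <;> simp
  induction n, hn using Nat.le_induction with
  | base => norm_num [Nat.factorial]
  | succ m hm ih =>
    have hm0 : (2 : ℝ) ≤ m := by exact_mod_cast hm
    have h1 : Real.log ((m + 1 : ℕ) : ℝ) - Real.log m ≤ 1 / m := by
      have := Real.log_le_sub_one_of_pos (x := ((m + 1 : ℕ) : ℝ) / m) (by positivity)
      rw [Real.log_div (by positivity) (by positivity)] at this
      refine this.trans_eq ?_
      push_cast; field_simp; ring
    have h2 : 1 ≤ Real.log ((m + 1 : ℕ) : ℝ) := by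
      rw [Real.le_log_iff_exp_le (by positivity)]
      push_cast
      linarith [Real.exp_one_lt_d9]
    have h3 : (m : ℝ) * (Real.log ((m + 1 : ℕ) : ℝ) - Real.log m) ≤ 1 := by
      calc _ ≤ (m : ℝ) * (1 / m) := by gcongr
        _ = 1 := by field_simp
    rw [Nat.factorial_succ, Nat.cast_mul, Real.log_mul (by positivity) (by positivity)]
    push_cast at *
    nlinarith

/-- For fixed `l` the sum over `k < l` is the harmonic number `H_l ≥ log (l+1)`. -/
theorem log_factorial_le_sum_hilbertKernel (n : ℕ) :
    Real.log (n.factorial : ℝ)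
      ≤ ∑ k : Fin n, ∑ l : Fin n, if k < l then hilbertKernel k l else 0 := by
  have h1 : ∑ k : Fin n, ∑ l : Fin n, (if k < l then hilbertKernel k l else 0)
      = ∑ l ∈ Finset.range n, ∑ k ∈ Finset.range l, hilbertKernel k l := by
    rw [Finset.sum_comm, Finset.sum_range]
    refine Finset.sum_congr rfl fun l _ => ?_
    have h := Finset.sum_range (n := n) (fun k => if k < (l : ℕ) then hilbertKernel k l else 0)
    simp only [Fin.lt_def]
    rw [← h, ← Finset.sum_filter]
    refine Finset.sum_congr ?_ fun _ _ => rfl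
    ext k
    simp only [Finset.mem_filter, Finset.mem_range]
    exact ⟨fun h => h.2, fun h => ⟨h.trans l.2, h⟩⟩
  have h2 : ∀ l : ℕ, Real.log ((l + 1 : ℕ) : ℝ) ≤ ∑ k ∈ Finset.range l, hilbertKernel k l := by
    intro l
    refine (log_add_one_le_harmonic l).trans_eq ?_
    rw [harmonic, ← Finset.sum_range_reflect, Rat.cast_sum]
    refine Finset.sum_congr rfl fun k hk => ?_
    rw [Finset.mem_range] at hk
    rw [hilbertKernel]
    push_cast [Nat.cast_sub (show k ≤ l - 1 by omega), Nat.cast_sub (show 1 ≤ l by omega)]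
    congr 1; ring
  rw [h1]
  have h3 : Real.log (n.factorial : ℝ) = ∑ l ∈ Finset.range n, Real.log ((l + 1 : ℕ) : ℝ) := by
    rw [← Finset.prod_range_add_one_eq_factorial, Nat.cast_prod, Real.log_prod]
    intro i _
    positivity
  rw [h3]
  exact Finset.sum_le_sum fun l _ => h2 l

theorem exp_sub_exp_neg (a b : ℝ) :
    Complex.exp (a * Complex.I) - Complex.exp ((-b : ℝ) * Complex.I)
      = Complex.exp (((a - b) / 2 : ℝ) * Complex.I)
        * (2 * Complex.I * (Real.sin ((a + b) / 2) : ℂ)) := by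
  have h1 : 2 * Complex.I * (Real.sin ((a + b) / 2) : ℂ)
      = Complex.exp (((a + b) / 2 : ℝ) * Complex.I)
        - Complex.exp (-(((a + b) / 2 : ℝ) * Complex.I)) := by
    rw [Complex.ofReal_sin, Complex.sin, neg_mul]
    linear_combination (Complex.exp (-(((a + b) / 2 : ℝ) * Complex.I))
      - Complex.exp (((a + b) / 2 : ℝ) * Complex.I)) * Complex.I_sq
  rw [h1, mul_sub, ← Complex.exp_add, ← Complex.exp_add]
  congr 2 <;> push_cast <;> ring

theorem sin_half_add_pos {a b : ℝ} (ha : 0 < a) (ha1 : a ≤ 1) (hb : 0 ≤ b) (hb1 : b ≤ 1) :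
    0 < Real.sin ((a + b) / 2) :=
  Real.sin_pos_of_pos_of_lt_pi (by linarith) (by linarith [Real.pi_gt_three])

theorem exp_ne_exp_neg {a b : ℝ} (ha : 0 < a) (ha1 : a ≤ 1) (hb : 0 ≤ b) (hb1 : b ≤ 1) :
    Complex.exp (a * Complex.I) ≠ Complex.exp ((-b : ℝ) * Complex.I) := by
  rw [← sub_ne_zero, exp_sub_exp_neg]
  have : (Real.sin ((a + b) / 2) : ℂ) ≠ 0 := by
    exact_mod_cast (sin_half_add_pos ha ha1 hb hb1).ne'
  exact mul_ne_zero (Complex.exp_ne_zero _) (mul_ne_zero (by simp) this)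

/-- As `f(1) = 0`, the factor `z - 1` cancels: `f^{[1]}(z, 1) = g(z)` and `f^{[1]}(1, w) = g(w)`. -/
theorem dividedDiff₂_fFun_one (h : ℝ → ℝ) {z w : ℂ} (hz : z ≠ 1) (hw : w ≠ 1) (hzw : z ≠ w) :
    dividedDiff₂ (fFun h) z 1 w = (circleFun h z - circleFun h w) / (z - w) := by
  have hz' : z - 1 ≠ 0 := sub_ne_zero.2 hz
  have hw' : 1 - w ≠ 0 := sub_ne_zero.2 hw.symm
  rw [dividedDiff₂, if_neg hzw, dividedDiff₁, if_neg hz, dividedDiff₁, if_neg hw.symm]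
  congr 2
  · simp only [fFun, sub_self, zero_mul, sub_zero]
    field_simp
  · simp only [fFun, sub_self, zero_mul, zero_sub]
    field_simp
    ring

/-- The angles `e^{-(k+1)}`. -/
def angle (k : ℕ) : ℝ := Real.exp (-((k : ℝ) + 1))

theorem angle_pos (k : ℕ) : 0 < angle k := Real.exp_pos _

theorem angle_le (k : ℕ) : angle k ≤ Real.exp (-1) :=
  Real.exp_le_exp.2 (by linarith [(Nat.cast_nonneg k : (0 : ℝ) ≤ k)])

theorem angle_le_one (k : ℕ) : angle k ≤ 1 :=
  Real.exp_le_one_iff.2 (by linarith [(Nat.cast_nonneg k : (0 : ℝ) ≤ k)])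

theorem two_mul_angle_le {k l : ℕ} (h : k < l) : 2 * angle l ≤ angle k := by
  have h1 : angle l ≤ Real.exp (-1) * angle k := by
    rw [angle, angle, ← Real.exp_add, Real.exp_le_exp]
    have : (k : ℝ) + 1 ≤ l := by exact_mod_cast h
    linarith
  have h2 : 2 * Real.exp (-1) ≤ 1 := by
    rw [Real.exp_neg, ← div_eq_mul_inv, div_le_one (Real.exp_pos _)]
    linarith [Real.exp_one_gt_d9]
  nlinarith [angle_pos k]

/-- The factor `(log (k+2))^{-1/2}` of `h₀` at `±angle k`. -/
def weight (k : ℕ) : ℝ := Real.log ((k : ℝ) + 2) ^ (-(1 / 2) : ℝ)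

theorem weight_pos (k : ℕ) : 0 < weight k :=
  Real.rpow_pos_of_pos (Real.log_pos (by linarith [(Nat.cast_nonneg k : (0 : ℝ) ≤ k)])) _

theorem weight_antitone : Antitone weight := by
  intro k l hkl
  have hk : (0 : ℝ) ≤ k := Nat.cast_nonneg k
  have : (k : ℝ) ≤ l := by exact_mod_cast hkl
  exact Real.rpow_le_rpow_of_nonpos (Real.log_pos (by linarith))
    (Real.log_le_log (by linarith) (by linarith)) (by norm_num)

theorem h₀_of_abs_eq_angle {x : ℝ} {k : ℕ} (hx : |x| = angle k) : h₀ x = weight k * angle k := by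
  have hx0 : x ≠ 0 := abs_pos.1 (hx ▸ angle_pos k)
  have hlog : |Real.log (angle k / Real.exp 1)| = (k : ℝ) + 2 := by
    rw [angle, ← Real.exp_sub, Real.log_exp, abs_of_neg (by
      linarith [(Nat.cast_nonneg k : (0 : ℝ) ≤ k)])]
    ring
  rw [h₀, if_neg hx0, hx, hlog, weight, mul_comm]

variable {h : ℝ → ℝ}

theorem IsAdmissible.apply_angle (hh : IsAdmissible h) (k : ℕ) :
    h (angle k) = weight k * angle k := by
  rw [hh.eq_h₀ _ ⟨by linarith [angle_pos k, Real.exp_pos (-1)], angle_le k⟩]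
  exact h₀_of_abs_eq_angle (abs_of_pos (angle_pos k))

theorem IsAdmissible.apply_neg_angle (hh : IsAdmissible h) (k : ℕ) :
    h (-angle k) = weight k * angle k := by
  rw [hh.eq_h₀ _ ⟨by linarith [angle_le k], by linarith [angle_pos k, Real.exp_pos (-1)]⟩]
  exact h₀_of_abs_eq_angle (by rw [abs_neg, abs_of_pos (angle_pos k)])

/-- The modulus, up to sign, of the divided difference of `g` at `e^{i angle k}`,
`e^{-i angle l}`. -/
def symbol (k l : ℕ) : ℝ :=
  (weight k * angle k - weight l * angle l) / (2 * Real.sin ((angle k + angle l) / 2))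

theorem symbol_swap (k l : ℕ) : symbol l k = -symbol k l := by
  rw [symbol, symbol, add_comm (angle l), ← neg_div, neg_sub]

/-- With `a_l ≤ a_k / 2`, the numerator is at least `weight k * a_k / 2` and the denominator at most
`3 a_k / 2`. The bound does not decay as `l` grows. -/
theorem weight_div_four_le_symbol {k l : ℕ} (hkl : k < l) : weight k / 4 ≤ symbol k l := by
  have hs := sin_half_add_pos (angle_pos k) (angle_le_one k) (angle_pos l).le (angle_le_one l)
  have hs' : Real.sin ((angle k + angle l) / 2) ≤ (angle k + angle l) / 2 :=
    Real.sin_le (by linarith [angle_pos k, angle_pos l])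
  have h2 := two_mul_angle_le hkl
  rw [symbol, le_div_iff₀ (by positivity)]
  have hw := weight_pos k
  have e1 : weight l * angle l ≤ weight k * angle l :=
    mul_le_mul_of_nonneg_right (weight_antitone hkl.le) (angle_pos l).le
  have e2 : weight k / 4 * (2 * Real.sin ((angle k + angle l) / 2))
      ≤ weight k / 4 * (angle k + angle l) := by
    gcongr; linarith
  have e3 : weight k * (2 * angle l) ≤ weight k * angle k := by gcongr
  have e4 : 0 < weight k * angle k := mul_pos hw (angle_pos k)
  linarith

theorem hilbertKernel_swap (k l : ℕ) : hilbertKernel l k = -hilbertKernel k l := by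
  rw [hilbertKernel, hilbertKernel, ← inv_neg, neg_sub]

theorem hilbertKernel_pos {k l : ℕ} (hkl : k < l) : 0 < hilbertKernel k l :=
  inv_pos.2 (sub_pos.2 (by exact_mod_cast hkl))

/-- Both factors change sign under swapping `k` and `l`, so no term is negative and those with `k <
l` suffice. -/
theorem sum_hilbertKernel_mul_symbol_ge (n : ℕ) :
    weight n / 4 * ((n : ℝ) / 2 * Real.log n)
      ≤ ∑ k : Fin n, ∑ l : Fin n, hilbertKernel k l * symbol k l := by
  refine (mul_le_mul_of_nonneg_left ((half_mul_log_le_log_factorial n).trans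
    (log_factorial_le_sum_hilbertKernel n)) (by linarith [weight_pos n])).trans ?_
  have hlt : ∀ k l : Fin n, k < l →
      weight n / 4 * hilbertKernel k l ≤ hilbertKernel k l * symbol k l := by
    intro k l hkl
    rw [mul_comm]
    refine mul_le_mul_of_nonneg_left ?_ (hilbertKernel_pos hkl).le
    linarith [weight_antitone k.2.le, weight_div_four_le_symbol hkl]
  simp only [Finset.mul_sum]
  refine Finset.sum_le_sum fun k _ => Finset.sum_le_sum fun l _ => ?_
  split_ifs with hkl
  · exact hlt k l hkl
  · rw [mul_zero]
    rcases eq_or_lt_of_le (not_lt.1 hkl) with e | e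
    · simp [e, hilbertKernel]
    · rw [hilbertKernel_swap, symbol_swap, neg_mul_neg]
      exact (mul_pos (div_pos (weight_pos n) (by norm_num)) (hilbertKernel_pos e)).le.trans
        (hlt l k e)

theorem half_log_rpow_le_weight_mul_log {n : ℕ} (hn : 3 ≤ n) :
    1 / 2 * Real.log n ^ (1 / 2 : ℝ) ≤ weight n * Real.log n := by
  have hn' : (3 : ℝ) ≤ n := by exact_mod_cast hn
  have hL : 0 < Real.log n := Real.log_pos (by linarith)
  -- The exponent `4` is chosen so that `4^{-1/2} = 1/2`.
  have h1 : Real.log ((n : ℝ) + 2) ≤ 4 * Real.log n := by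
    have : (4 : ℝ) * Real.log n = Real.log ((n : ℝ) ^ 4) := by rw [Real.log_pow]; norm_num
    rw [this]
    refine Real.log_le_log (by linarith) ?_
    nlinarith [sq_nonneg ((n : ℝ) ^ 2 - 1)]
  have h2 : (4 * Real.log n) ^ (-(1 / 2) : ℝ) ≤ weight n :=
    Real.rpow_le_rpow_of_nonpos (Real.log_pos (by linarith)) h1 (by norm_num)
  have h4 : (4 : ℝ) ^ (-(1 / 2) : ℝ) = 1 / 2 := by
    rw [show (4 : ℝ) = 2 ^ (2 : ℝ) by norm_num, ← Real.rpow_mul (by norm_num)]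
    norm_num [Real.rpow_neg_one]
  rw [Real.mul_rpow (by norm_num) hL.le, h4] at h2
  refine le_trans (le_of_eq ?_) (mul_le_mul_of_nonneg_right h2 hL.le)
  rw [mul_assoc]
  congr 1
  nth_rewrite 3 [← Real.rpow_one (Real.log n)]
  rw [← Real.rpow_add hL]
  norm_num

end Estimates

/-! ### The bordered perturbation of a diagonal unitary. -/

section Construction

variable {ι : Type*} [Fintype ι] [DecidableEq ι]

/-- The self-adjoint matrix `v eₒ* + eₒ v*`, for a real vector `v` with `v o = 0`. -/
def bordered (o : ι) (v : ι → ℝ) : Matrix ι ι ℂ :=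
  Matrix.of fun i j => if j = o then (v i : ℂ) else if i = o then (v j : ℂ) else 0

theorem isSelfAdjoint_bordered (o : ι) (v : ι → ℝ) :
    IsSelfAdjoint (Matrix.toEuclideanCLM (n := ι) (𝕜 := ℂ) (bordered o v)) := by
  rw [IsSelfAdjoint, ← map_star]
  congr 1
  ext i j
  simp only [bordered, Matrix.star_apply, Matrix.of_apply]
  split_ifs with h1 h2 <;> simp [*]

theorem schattenNorm_two_bordered_le (o : ι) (v : ι → ℝ) (hv : ∑ i, v i ^ 2 ≤ 1 / 2) :
    schattenNorm 2 (Matrix.toEuclideanCLM (n := ι) (𝕜 := ℂ) (bordered o v)) ≤ 1 := by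
  rw [schattenNorm_two_eq (EuclideanSpace.basisFun ι ℂ), Real.sqrt_le_one]
  have h1 : ∀ j, ‖Matrix.toEuclideanCLM (n := ι) (𝕜 := ℂ) (bordered o v)
      (EuclideanSpace.basisFun ι ℂ j)‖ ^ 2 = ∑ i, ‖bordered o v i j‖ ^ 2 := by
    intro j
    rw [EuclideanSpace.norm_sq_eq]
    simp [Matrix.ofLp_toEuclideanCLM]
  have h2 : ∀ i j, ‖bordered o v i j‖ ^ 2
      ≤ (if j = o then v i ^ 2 else 0) + (if i = o then v j ^ 2 else 0) := by
    intro i j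
    have a1 := sq_nonneg (v i)
    have a2 := sq_nonneg (v j)
    simp only [bordered, Matrix.of_apply]
    split_ifs <;> (simp; try assumption)
  simp only [h1]
  calc ∑ j, ∑ i, ‖bordered o v i j‖ ^ 2
      ≤ ∑ j, ∑ i, ((if j = o then v i ^ 2 else 0) + (if i = o then v j ^ 2 else 0)) :=
        Finset.sum_le_sum fun j _ => Finset.sum_le_sum fun i _ => h2 i j
    _ = ∑ i, v i ^ 2 + ∑ i, v i ^ 2 := by
        simp only [Finset.sum_add_distrib, Finset.sum_ite_eq', Finset.mem_univ, if_true]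
        congr 1
        rw [Finset.sum_comm]
        simp
    _ ≤ 1 := by linarith

theorem diagonal_exp_mem_unitary (θ : ι → ℝ) :
    Matrix.toEuclideanCLM (n := ι) (𝕜 := ℂ)
        (Matrix.diagonal fun i => Complex.exp (θ i * Complex.I))
      ∈ unitary (EuclideanSpace ℂ ι →L[ℂ] EuclideanSpace ℂ ι) := by
  have h : ∀ i, (starRingEnd ℂ) (Complex.exp (θ i * Complex.I)) * Complex.exp (θ i * Complex.I)
      = 1 := by
    intro i
    rw [mul_comm, Complex.mul_conj', Complex.norm_exp_ofReal_mul_I]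
    simp
  have h' : ∀ i, Complex.exp (θ i * Complex.I) * (starRingEnd ℂ) (Complex.exp (θ i * Complex.I))
      = 1 := fun i => by rw [mul_comm, h]
  rw [Unitary.mem_iff, ← map_star, ← map_mul, ← map_mul, Matrix.star_eq_conjTranspose,
    Matrix.diagonal_conjTranspose, Matrix.diagonal_mul_diagonal, Matrix.diagonal_mul_diagonal]
  simp only [Pi.star_apply, RCLike.star_def, h, h', Matrix.diagonal_one, map_one, and_self]

/-- The entry at `(i, j)` of the triple operator integral of a bordered perturbation of a diagonal
operator only involves the border. -/
theorem sum_bordered_entry (ψ : ℂ → ℂ → ℂ → ℂ) (z : ι → ℂ) (o : ι) (v : ι → ℝ) {i j : ι}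
    (hi : i ≠ o) (hj : j ≠ o) :
    ∑ k, ψ (z i) (z k) (z j) * (bordered o v * Matrix.diagonal z) i k
        * (bordered o v * Matrix.diagonal z) k j
      = ψ (z i) (z o) (z j) * z o * z j * (v i * v j) := by
  rw [Finset.sum_eq_single_of_mem o (Finset.mem_univ _)]
  · simp only [Matrix.mul_diagonal, bordered, Matrix.of_apply, if_true, if_neg hj]
    ring
  · intro k _ hk
    simp [Matrix.mul_diagonal, bordered, hk, hi]

/-- Unimodular factors depending on `k` or `l` alone are absorbed into `x` and `y`. -/
theorem norm_sum_phase_hilbertKernel_le {n : ℕ} (x y : Fin n → ℂ) :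
    ‖∑ k : Fin n, ∑ l : Fin n, ((hilbertKernel k l : ℂ) * (Complex.I
        * Complex.exp ((angle k / 2 : ℝ) * Complex.I)
        * Complex.exp ((angle l / 2 : ℝ) * Complex.I))) * x k * y l‖
      ≤ Real.pi * (√(∑ k, ‖x k‖ ^ 2) * √(∑ l, ‖y l‖ ^ 2)) := by
  have h := norm_sum_hilbertKernel_le
    (fun k : Fin n => Complex.I * Complex.exp ((angle k / 2 : ℝ) * Complex.I) * x k)
    (fun l : Fin n => Complex.exp ((angle l / 2 : ℝ) * Complex.I) * y l)
  simp only [norm_mul, Complex.norm_I, Complex.norm_exp_ofReal_mul_I, one_mul] at h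
  refine le_trans (le_of_eq ?_) h
  congr 1
  refine Finset.sum_congr rfl fun k _ => Finset.sum_congr rfl fun l _ => ?_
  ring

/-- The phases turn the divided differences of `g` into the real symbol. -/
theorem IsAdmissible.phase_mul_dividedDiff {h : ℝ → ℝ} (hh : IsAdmissible h) (k l : ℕ) :
    (Complex.I * Complex.exp ((angle k / 2 : ℝ) * Complex.I)
        * Complex.exp ((angle l / 2 : ℝ) * Complex.I))
      * (dividedDiff₂ (fFun h) (Complex.exp (angle k * Complex.I)) 1
          (Complex.exp ((-angle l : ℝ) * Complex.I))
        * Complex.exp ((-angle l : ℝ) * Complex.I)) = symbol k l := by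
  have hz : Complex.exp (angle k * Complex.I) ≠ 1 := by
    simpa using exp_ne_exp_neg (angle_pos k) (angle_le_one k) le_rfl zero_le_one
  have hw : Complex.exp ((-angle l : ℝ) * Complex.I) ≠ 1 := by
    intro e
    have h1 := exp_ne_exp_neg (angle_pos l) (angle_le_one l) le_rfl zero_le_one
    rw [Complex.ofReal_neg, neg_mul, Complex.exp_neg, inv_eq_one] at e
    simp [e] at h1
  have hzw := exp_ne_exp_neg (angle_pos k) (angle_le_one k) (angle_pos l).le (angle_le_one l)
  have hs : (Real.sin ((angle k + angle l) / 2) : ℂ) ≠ 0 := by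
    exact_mod_cast
      (sin_half_add_pos (angle_pos k) (angle_le_one k) (angle_pos l).le (angle_le_one l)).ne'
  have hI := Complex.I_ne_zero
  have he := Complex.exp_ne_zero (((angle k - angle l) / 2 : ℝ) * Complex.I)
  -- This cancels the unimodular factor of `z - w` from `exp_sub_exp_neg`; the last exponential is
  -- the eigenvalue contributed by the right-hand factor `U`.
  have hphase : Complex.exp ((angle k / 2 : ℝ) * Complex.I)
        * Complex.exp ((angle l / 2 : ℝ) * Complex.I) * Complex.exp ((-angle l : ℝ) * Complex.I)
      = Complex.exp (((angle k - angle l) / 2 : ℝ) * Complex.I) := by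
    rw [← Complex.exp_add, ← Complex.exp_add]
    congr 1; push_cast; ring
  rw [dividedDiff₂_fFun_one h hz hw hzw, circleFun_exp hh.periodic, circleFun_exp hh.periodic,
    hh.apply_angle, hh.apply_neg_angle, exp_sub_exp_neg, symbol]
  calc _ = Complex.I * (Complex.exp ((angle k / 2 : ℝ) * Complex.I)
        * Complex.exp ((angle l / 2 : ℝ) * Complex.I) * Complex.exp ((-angle l : ℝ) * Complex.I))
        * ((((weight k * angle k : ℝ) : ℂ) - ((weight l * angle l : ℝ) : ℂ))
          / (Complex.exp (((angle k - angle l) / 2 : ℝ) * Complex.I)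
            * (2 * Complex.I * (Real.sin ((angle k + angle l) / 2) : ℂ)))) := by ring
    _ = _ := by
      rw [hphase, Complex.ofReal_div (_ - _) (2 * _), Complex.ofReal_sub (_ * _),
        Complex.ofReal_mul 2, Complex.ofReal_ofNat]
      field_simp

/-- A diagonal unitary with eigenvalues `1`, `e^{i angle k}`, `e^{-i angle l}` and a perturbation
bordered at the eigenvalue `1`, constant on the other two groups of eigenvalues. -/
theorem IsAdmissible.le_schattenNorm_one {h : ℝ → ℝ} (hh : IsAdmissible h) {n : ℕ} (θ v : ι → ℝ)
    (o : ι) (p q : Fin n → ι) (hp : Function.Injective p) (hq : Function.Injective q)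
    (hpo : ∀ k, p k ≠ o) (hqo : ∀ l, q l ≠ o) (ho : θ o = 0)
    (hθp : ∀ k, θ (p k) = angle k) (hθq : ∀ l, θ (q l) = -angle l)
    {s : ℝ} (hvp : ∀ k, v (p k) = s) (hvq : ∀ l, v (q l) = s) {z : ι → ℂ}
    (hz : z = fun i => Complex.exp (θ i * Complex.I)) :
    s ^ 2 * (weight n / 4 * ((n : ℝ) / 2 * Real.log n))
      ≤ Real.pi * schattenNorm 1 (tripleOperatorIntegral (dividedDiff₂ (fFun h))
          (Matrix.toEuclideanCLM (n := ι) (𝕜 := ℂ) (Matrix.diagonal z))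
          (Matrix.toEuclideanCLM (n := ι) (𝕜 := ℂ) (Matrix.diagonal z))
          (Matrix.toEuclideanCLM (n := ι) (𝕜 := ℂ) (Matrix.diagonal z))
          (Matrix.toEuclideanCLM (n := ι) (𝕜 := ℂ) (bordered o v)
            * Matrix.toEuclideanCLM (n := ι) (𝕜 := ℂ) (Matrix.diagonal z))
          (Matrix.toEuclideanCLM (n := ι) (𝕜 := ℂ) (bordered o v)
            * Matrix.toEuclideanCLM (n := ι) (𝕜 := ℂ) (Matrix.diagonal z))) := by
  rw [← map_mul, tripleOperatorIntegral_diagonal]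
  refine le_trans ?_ (norm_sum_mul_le_schattenNorm_one _ norm_sum_phase_hilbertKernel_le
    Real.pi_pos.le p q hp hq _)
  have hsum : ∑ k : Fin n, ∑ l : Fin n, ((hilbertKernel k l : ℂ) * (Complex.I
        * Complex.exp ((angle k / 2 : ℝ) * Complex.I)
        * Complex.exp ((angle l / 2 : ℝ) * Complex.I)))
      * (Matrix.of fun i j => ∑ m, dividedDiff₂ (fFun h) (z i) (z m) (z j)
        * (bordered o v * Matrix.diagonal z) i m
        * (bordered o v * Matrix.diagonal z) m j) (p k) (q l)
      = ((s ^ 2 * ∑ k : Fin n, ∑ l : Fin n, hilbertKernel k l * symbol k l : ℝ) : ℂ) := by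
    simp only [Complex.ofReal_mul, Complex.ofReal_sum, Complex.ofReal_pow, Finset.mul_sum]
    refine Finset.sum_congr rfl fun k _ => Finset.sum_congr rfl fun l _ => ?_
    have hzo : z o = 1 := by simp [hz, ho]
    have hzp : z (p k) = Complex.exp (angle k * Complex.I) := by simp [hz, hθp]
    have hzq : z (q l) = Complex.exp ((-angle l : ℝ) * Complex.I) := by simp only [hz, hθq]
    rw [Matrix.of_apply, sum_bordered_entry _ _ _ _ (hpo k) (hqo l), hzo, hzp, hzq, hvp, hvq,
      ← hh.phase_mul_dividedDiff k l]
    ring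
  rw [hsum, Complex.norm_real]
  refine le_trans ?_ (Real.le_norm_self _)
  exact mul_le_mul_of_nonneg_left (sum_hilbertKernel_mul_symbol_ge n) (sq_nonneg s)

theorem sum_fin_ite_sq_le {n N : ℕ} (hn : 0 < n) :
    ∑ i : Fin N, (if 1 ≤ (i : ℕ) ∧ (i : ℕ) ≤ 2 * n then (2 * √(n : ℝ))⁻¹ else 0) ^ 2
      ≤ (1 / 2 : ℝ) := by
  rw [Fin.sum_univ_eq_sum_range
    (fun i : ℕ => (if 1 ≤ i ∧ i ≤ 2 * n then (2 * √(n : ℝ))⁻¹ else 0) ^ 2) N]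
  have hn' : (0 : ℝ) < n := by exact_mod_cast hn
  have hsq : ((2 * √(n : ℝ))⁻¹) ^ 2 = (4 * (n : ℝ))⁻¹ := by
    rw [inv_pow, mul_pow, Real.sq_sqrt hn'.le]; norm_num
  simp only [ite_pow, hsq, ne_eq, OfNat.ofNat_ne_zero, not_false_eq_true, zero_pow]
  rw [← Finset.sum_filter, Finset.sum_const, nsmul_eq_mul]
  have hcard : (Finset.filter (fun i => 1 ≤ i ∧ i ≤ 2 * n) (Finset.range N)).card ≤ 2 * n := by
    calc _ ≤ (Finset.Icc 1 (2 * n)).card := Finset.card_le_card fun i hi => by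
            simpa using (Finset.mem_filter.1 hi).2
      _ = 2 * n := by simp
  calc _ ≤ ((2 * n : ℕ) : ℝ) * (4 * (n : ℝ))⁻¹ := by gcongr
    _ = 1 / 2 := by push_cast; field_simp; norm_num

end Construction

end PellerUnitary

end

/-! ### Choice of eigenvalues, perturbation and constant. -/

theorem corollary4p6 (h : ℝ → ℝ) (hh : PellerUnitary.IsAdmissible h) :
    ∃ c : ℝ, 0 < c ∧ ∀ n : ℕ, 3 ≤ n →
      ∃ W U : EuclideanSpace ℂ (Fin (8 * n + 4)) →L[ℂ] EuclideanSpace ℂ (Fin (8 * n + 4)),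
        IsSelfAdjoint W ∧ PellerUnitary.schattenNorm 2 W ≤ 1 ∧
        U ∈ unitary (EuclideanSpace ℂ (Fin (8 * n + 4)) →L[ℂ]
          EuclideanSpace ℂ (Fin (8 * n + 4))) ∧
        c * Real.log n ^ (1 / 2 : ℝ) ≤
          PellerUnitary.schattenNorm 1
            (PellerUnitary.tripleOperatorIntegral
              (PellerUnitary.dividedDiff₂ (PellerUnitary.fFun h)) U U U (W * U) (W * U)) := by
  have hpi := Real.pi_pos
  -- `1/(4n) · 1/4 · n/2 = 1/32` from `s ^ 2` and the pairing, `1/2` from comparing `log (n+2)` with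
  -- `log n`, and `π` from Hilbert's inequality.
  refine ⟨1 / (64 * Real.pi), by positivity, fun n hn => ?_⟩
  have hn0 : (0 : ℝ) < n := by exact_mod_cast (show 0 < n by omega)
  -- Index `0` carries the eigenvalue `1`, indices `1..n` the positive angles, `n+1..2n` the
  -- negative ones. The rest is padding, where `v` vanishes.
  let θ : Fin (8 * n + 4) → ℝ := fun i =>
    if (i : ℕ) = 0 then 0
    else if (i : ℕ) ≤ n then PellerUnitary.angle (i - 1) else -PellerUnitary.angle (i - 1 - n)
  let v : Fin (8 * n + 4) → ℝ := fun i =>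
    if 1 ≤ (i : ℕ) ∧ (i : ℕ) ≤ 2 * n then (2 * √(n : ℝ))⁻¹ else 0
  let p : Fin n → Fin (8 * n + 4) := fun k => ⟨k + 1, by omega⟩
  let q : Fin n → Fin (8 * n + 4) := fun l => ⟨l + 1 + n, by omega⟩
  refine ⟨Matrix.toEuclideanCLM (n := Fin (8 * n + 4)) (𝕜 := ℂ) (PellerUnitary.bordered 0 v),
    Matrix.toEuclideanCLM (n := Fin (8 * n + 4)) (𝕜 := ℂ)
      (Matrix.diagonal fun i => Complex.exp (θ i * Complex.I)),
    PellerUnitary.isSelfAdjoint_bordered _ _,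
    PellerUnitary.schattenNorm_two_bordered_le _ _
      (PellerUnitary.sum_fin_ite_sq_le (by omega)),
    PellerUnitary.diagonal_exp_mem_unitary θ, ?_⟩
  have key := hh.le_schattenNorm_one θ v 0 p q
    (fun a b hab => by simpa [p, Fin.ext_iff] using hab)
    (fun a b hab => by simpa [q, Fin.ext_iff] using hab)
    (fun k => by simp [p, Fin.ext_iff]) (fun l => by simp [q, Fin.ext_iff])
    (by simp [θ])
    (fun k => by
      have : (k : ℕ) + 1 ≤ n := k.2
      simp [θ, p, this])
    (fun l => by
      have : ¬ ((l : ℕ) + 1 + n ≤ n) := by omega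
      have e : (l : ℕ) + 1 + n - 1 - n = l := by omega
      simp only [θ, q, this, e, if_false]
      simp)
    (s := (2 * √(n : ℝ))⁻¹)
    (fun k => if_pos ⟨by simp [p], by simp only [p]; omega⟩)
    (fun l => if_pos ⟨by simp only [q]; omega, by simp only [q]; omega⟩) rfl
  have hsq : ((2 * √(n : ℝ))⁻¹) ^ 2 = (4 * (n : ℝ))⁻¹ := by
    rw [inv_pow, mul_pow, Real.sq_sqrt hn0.le]; norm_num
  rw [hsq] at key
  have hw := PellerUnitary.half_log_rpow_le_weight_mul_log hn
  rw [← mul_le_mul_iff_right₀ hpi]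
  refine le_trans ?_ key
  calc Real.pi * (1 / (64 * Real.pi) * Real.log n ^ (1 / 2 : ℝ))
      = 1 / 32 * (1 / 2 * Real.log n ^ (1 / 2 : ℝ)) := by field_simp; ring
    _ ≤ 1 / 32 * (PellerUnitary.weight n * Real.log n) := by gcongr
    _ = _ := by field_simp; ring
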